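/- **Setting.** In the variable-processor cup game there are $n\ge 1$ cups with real fills $x_1,\dots,x_n$, all initially $0$. In each round the filler chooses an integer $1\le p\le n$ and reals $a_1,\dots,a_n\in[0,1]$ with $\sum_i a_i=p$, and replaces each $x_i$ by $x_i'=x_i+a_i$. Then the emptier chooses a set $S$ of exactly $p$ cups and replaces $x_i'$ by $\max(0,x_i'-1)$ for each $i\in S$, leaving the other cups unchanged. The emptier is *greedy* if $S$ always consists of $p$ fullest cups with respect to $x_1',\dots,x_n'$ (ties broken arbitrarily). The *backlog* of a state is $\max_i x_i$, evaluated at the end of a round. Let $\log$ be the natural logarithm and put $$b_n(t)=\begin{cases} t & \text{if } t\le \log n,\\ t^{1/3}\log^{2/3}\!\left(\frac{n^3}{t}+1\right) & \text{if } \log n<t\le n^3,\\ n & \text{if } t>n^3.\end{cases}$$ **Theorem.** Suppose the emptier is greedy. 1. For every constant $C>0$ there is a constant $c>0$, depending only on $C$, such that for all $n\ge 1$ and all real $k$ with $1\le k\le Cn$: whatever the filler does, if the backlog is at least $k$ after $t$ rounds, then $$t\ \ge\ c\left(k+\frac{k^3}{\log^2\left(\frac nk+1\right)}\right).$$ 2.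 There is an absolute constant $C>0$ such that for all $n\ge 1$ and $t\ge 1$, whatever the filler does, the backlog after $t$ rounds is at most $C\,b_n(t)$. 3. For every $\delta>0$ there is a constant $c>0$, depending only on $\delta$, such that for all $n\ge 1$: whatever the filler does, if the backlog is at least $\delta n$ after $t$ rounds, then $t\ge c\,n^3$. -/

import Mathlib

/-- A legal filler move with `p` processors on `n` cups: an integer `1 ≤ p ≤ n` and amounts
`a i ∈ [0, 1]` with total exactly `p`. -/
def IsFillerMove {n : ℕ} (p : ℕ) (a : Fin n → ℝ) : Prop :=
  1 ≤ p ∧ p ≤ n ∧ (∀ i, 0 ≤ a i ∧ a i ≤ 1) ∧ ∑ i, a i = (p : ℝ)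

/-- A greedy choice of `p` cups: `S` consists of `p` fullest cups of `x`
(ties may be broken in any way). -/
def IsGreedyChoice {n : ℕ} (x : Fin n → ℝ) (p : ℕ) (S : Finset (Fin n)) : Prop :=
  S.card = p ∧ ∀ i ∈ S, ∀ j ∉ S, x j ≤ x i

/-- Removing (up to) one unit of water from each cup of `S`; fills never become negative. -/
noncomputable def emptyCups {n : ℕ} (x : Fin n → ℝ) (S : Finset (Fin n)) : Fin n → ℝ :=
  fun i => if i ∈ S then max 0 (x i - 1) else x i

/-- One full round of the variable-processor cup game against a greedy emptier takes the
state `x` to the state `y`. -/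
def GreedyRound {n : ℕ} (x y : Fin n → ℝ) : Prop :=
  ∃ (p : ℕ) (a : Fin n → ℝ) (S : Finset (Fin n)),
    IsFillerMove p a ∧ IsGreedyChoice (x + a) p S ∧ y = emptyCups (x + a) S

/-- `GreedyReachable n t x`: in the variable-processor cup game on `n` initially empty cups,
some sequence of filler moves against a greedy emptier leads to the state `x` after exactly
`t` rounds. -/
inductive GreedyReachable (n : ℕ) : ℕ → (Fin n → ℝ) → Prop
  | start : GreedyReachable n 0 (fun _ => 0)
  | round {t : ℕ} {x y : Fin n → ℝ} (hx : GreedyReachable n t x) (hxy : GreedyRound x y) :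
      GreedyReachable n (t + 1) y

/-- The backlog of a state: the maximum fill (a maximum over finitely many cups). -/
noncomputable def backlog {n : ℕ} (x : Fin n → ℝ) : ℝ := ⨆ i, x i

/-- The trade-off curve `b(t)` for the game on `n` cups. -/
noncomputable def tradeoff (n t : ℕ) : ℝ :=
  if (t : ℝ) ≤ Real.log n then (t : ℝ)
  else if t ≤ n ^ 3 then
    (t : ℝ) ^ (1 / 3 : ℝ) * Real.log ((n : ℝ) ^ 3 / (t : ℝ) + 1) ^ (2 / 3 : ℝ)
  else (n : ℝ)

/-! Let F(h) be the total water above the integer level h ≥ 0. A greedy round can raise F at one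
level only, and there the new value is at most the mean of the two neighbouring old values minus 1/2
(`GreedyRound.overflow_le`). The game is thus a relaxation, one site at a time, of a discrete
Poisson equation. Its stationary solutions, the parabolas (J - h)²/2, are barriers; J = n gives F(0)
≤ n²/2 and backlog at most n.

For the time bound, the mean inequality is unrolled backwards from level b at time t: a unit mass
starts at b and splits to the neighbours wherever a round acts. Splitting mass m raises the second
moment V about b by m and the sum of pairwise distances by m². By Cauchy–Schwarz, N splits give V² ≤
N · spread (`IsRelaxation.exists_dual`), so with N ≤ w³/8 at most half of the mass gets to distance
w, and F(b) is at most half its boundary bound (`IsRelaxation.le_half`).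

If t ≤ m w³/8, at least m of 2m disjoint blocks are visited that rarely, so F ≤ 2⁻ᵐ n²/2 at level
4mw (`IsRelaxation.le_pow`). For m of order log(n/k + 1) this is at most (k/4)²/2, and a parabola
ends the profile about k/4 levels higher, below k. Taking w of order k/m forces t to be of order at
least m w³, that is k³/log²(n/k + 1). The trade-off curve is this bound inverted; the cubic bound is
the case k = δn. -/

/-! ### Overflow profile and its change in one greedy round -/

/-- The total amount of water above level `h`. -/
noncomputable def overflow {n : ℕ} (x : Fin n → ℝ) (h : ℤ) : ℝ := ∑ i, max (x i - h) 0

theorem overflow_anti {n : ℕ} (x : Fin n → ℝ) {h h' : ℤ} (hh : h ≤ h') :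
    overflow x h' ≤ overflow x h := by
  have : (h : ℝ) ≤ h' := by exact_mod_cast hh
  exact Finset.sum_le_sum fun i _ => max_le_max (by linarith) le_rfl

theorem overflow_sub_one_le {n : ℕ} (x : Fin n → ℝ) (h : ℤ) :
    overflow x (h - 1) ≤ overflow x h + n := by
  have : overflow x h + n = ∑ i, (max (x i - h) 0 + 1) := by
    simp [overflow, Finset.sum_add_distrib]
  rw [this]
  refine Finset.sum_le_sum fun i _ => max_le ?_ ?_
  · push_cast
    linarith [le_max_left (x i - h) 0]
  · linarith [le_max_right (x i - h) 0]

theorem le_of_overflow_nonpos {n : ℕ} {x : Fin n → ℝ} {h : ℤ} (hx : overflow x h ≤ 0)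
    (i : Fin n) : x i ≤ h := by
  have h1 : max (x i - h) 0 ≤ overflow x h :=
    Finset.single_le_sum (f := fun i => max (x i - (h : ℝ)) 0)
      (fun _ _ => le_max_right _ _) (Finset.mem_univ i)
  linarith [le_max_left (x i - h) 0]

theorem GreedyRound.nonneg {n : ℕ} {x y : Fin n → ℝ} (hxy : GreedyRound x y)
    (hx : ∀ i, 0 ≤ x i) (i : Fin n) : 0 ≤ y i := by
  obtain ⟨p, a, S, ⟨-, -, ha, -⟩, -, rfl⟩ := hxy
  unfold emptyCups
  split_ifs
  · exact le_max_left _ _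
  · exact add_nonneg (hx i) (ha i).1

theorem GreedyRound.le_add_one {n : ℕ} {x y : Fin n → ℝ} (hxy : GreedyRound x y)
    (hx : ∀ i, 0 ≤ x i) (i : Fin n) : y i ≤ x i + 1 := by
  obtain ⟨p, a, S, ⟨-, -, ha, -⟩, -, rfl⟩ := hxy
  have := hx i
  have := ha i
  unfold emptyCups
  split_ifs
  · exact max_le (by linarith) (by simp only [Pi.add_apply]; linarith)
  · simp only [Pi.add_apply]; linarith

/-- If every emptied cup stays above level `h ≥ 0`, or every other cup is at most at level `h`,
then the overflow above `h` does not increase. -/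
theorem overflow_emptyCups_le {n p : ℕ} {x a : Fin n → ℝ} {S : Finset (Fin n)} {h : ℤ}
    (ha : IsFillerMove p a) (hS : S.card = p) (hh : 0 ≤ h)
    (hc : (∀ i ∈ S, (h : ℝ) < x i + a i - 1) ∨ ∀ i ∉ S, x i + a i ≤ h) :
    overflow (emptyCups (x + a) S) h ≤ overflow x h := by
  obtain ⟨-, -, ha, hsum⟩ := ha
  have hh' : (0 : ℝ) ≤ h := by exact_mod_cast hh
  rcases hc with hc | hc
  · have h1 : overflow x h = ∑ i, (max (x i - h) 0 + (a i - if i ∈ S then 1 else 0)) := by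
      simp [overflow, Finset.sum_add_distrib, hsum, hS]
    rw [h1]
    refine Finset.sum_le_sum fun i _ => ?_
    have := ha i
    simp only [emptyCups, Pi.add_apply]
    split_ifs with hi
    · have := hc i hi
      rw [max_eq_right (a := (0 : ℝ)) (by linarith), max_eq_left (b := (0 : ℝ)) (by linarith)]
      linarith [le_max_left (x i - h) 0]
    · exact max_le (by linarith [le_max_left (x i - h) 0]) (by linarith [le_max_right (x i - h) 0])
  · refine Finset.sum_le_sum fun i _ => ?_
    have := ha i
    simp only [emptyCups, Pi.add_apply]
    split_ifs with hi
    · refine max_le ?_ (le_max_right _ _)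
      rcases max_cases 0 (x i + a i - 1) with ⟨h2, -⟩ | ⟨h2, -⟩ <;> rw [h2]
      · exact le_trans (by linarith) (le_max_right _ _)
      · exact le_trans (by linarith) (le_max_left _ _)
    · exact max_le (le_trans (by linarith [hc i hi]) (le_max_right _ _)) (le_max_right _ _)

/-- If some emptied cup ends at or below level `h` and some other cup is above it, then the
new overflow is at most the mean of the neighbouring old ones, less one half. -/
theorem overflow_emptyCups_le_mean {n p : ℕ} {x a : Fin n → ℝ} {S : Finset (Fin n)} {h : ℤ}
    {τ : ℝ} (ha : IsFillerMove p a) (hS : S.card = p) (hh : 0 ≤ h)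
    (hτS : ∀ i ∈ S, τ ≤ x i + a i) (hτ : ∀ i ∉ S, x i + a i ≤ τ)
    {i₀ j₀ : Fin n} (hi₀ : i₀ ∈ S) (hj₀ : j₀ ∉ S) (hi : x i₀ + a i₀ - 1 ≤ h)
    (hj : (h : ℝ) < x j₀ + a j₀) :
    overflow (emptyCups (x + a) S) h ≤ (overflow x (h - 1) + overflow x (h + 1) - 1) / 2 := by
  obtain ⟨-, -, ha, hsum⟩ := ha
  have hh' : (0 : ℝ) ≤ h := by exact_mod_cast hh
  -- The terms a i - 1_S sum to zero, so the bound can be checked cup by cup. The gain 1/2 is shared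
  -- by `i₀` and `j₀`: with h < τ ≤ h + 1, their slacks are at least (τ - h)/2 and (1 - (τ - h))/2.
  have h1 : (overflow x (h - 1) + overflow x (h + 1) - 1) / 2 =
      ∑ i, ((max (x i - h + 1) 0 + max (x i - h - 1) 0) / 2 +
        (a i - if i ∈ S then 1 else 0) / 2 - (if i = i₀ then (τ - h) / 2 else 0)
        - (if i = j₀ then (1 - (τ - h)) / 2 else 0)) := by
    have e1 : overflow x (h - 1) = ∑ i, max (x i - h + 1) 0 := by
      unfold overflow; refine Finset.sum_congr rfl fun i _ => ?_; push_cast; ring_nf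
    have e2 : overflow x (h + 1) = ∑ i, max (x i - h - 1) 0 := by
      unfold overflow; refine Finset.sum_congr rfl fun i _ => ?_; push_cast; ring_nf
    rw [Finset.sum_sub_distrib, Finset.sum_sub_distrib, Finset.sum_add_distrib,
      ← Finset.sum_div, ← Finset.sum_div, Finset.sum_sub_distrib, Finset.sum_add_distrib,
      e1, e2, hsum]
    simp [hS]
    ring
  rw [h1]
  have hτ1 : (h : ℝ) < τ := hj.trans_le (hτ _ hj₀)
  have hτ2 : τ ≤ h + 1 := by linarith [hτS _ hi₀]
  refine Finset.sum_le_sum fun i _ => ?_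
  obtain ⟨ha0, ha1⟩ := ha i
  have m1 := le_max_left (x i - h + 1) 0
  have m2 := le_max_right (x i - h + 1) 0
  have m3 := le_max_left (x i - h - 1) 0
  have m4 := le_max_right (x i - h - 1) 0
  simp only [emptyCups, Pi.add_apply]
  by_cases hiS : i ∈ S
  · have hne : i ≠ j₀ := fun e => hj₀ (e ▸ hiS)
    have := hτS i hiS
    simp only [hiS, if_true, hne, if_false]
    refine max_le ?_ ?_
    · rcases max_cases 0 (x i + a i - 1) with ⟨h2, -⟩ | ⟨h2, -⟩ <;> rw [h2]
      · split_ifs <;> linarith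
      · split_ifs with hii
        · subst hii; linarith
        · linarith
    · split_ifs <;> linarith
  · have hne : i ≠ i₀ := fun e => hiS (e ▸ hi₀)
    have := hτ i hiS
    simp only [hiS, if_false, hne]
    refine max_le ?_ ?_
    · split_ifs <;> linarith
    · split_ifs with hij
      · subst hij; linarith
      · linarith

/-- In one greedy round the overflow increases at no more than one integer level. -/
theorem GreedyRound.overflow_le {n : ℕ} {x y : Fin n → ℝ} (hxy : GreedyRound x y) :
    ∃ θ : ℤ, ∀ h : ℤ, 0 ≤ h → overflow y h ≤ overflow x h ∨
      (h = θ ∧ overflow y h ≤ (overflow x (h - 1) + overflow x (h + 1) - 1) / 2) := by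
  obtain ⟨p, a, S, ha, ⟨hS, hgr⟩, rfl⟩ := hxy
  have hne : S.Nonempty := Finset.card_pos.1 (by rw [hS]; exact ha.1)
  obtain ⟨i₁, hi₁, hmin⟩ := Finset.exists_min_image S (fun i => x i + a i) hne
  -- The unique integer h with h < τ ≤ h + 1, where τ is the lowest fill among the emptied cups
  -- before emptying.
  refine ⟨⌈x i₁ + a i₁⌉ - 1, fun h hh => ?_⟩
  by_cases hc : (∀ i ∈ S, (h : ℝ) < x i + a i - 1) ∨ ∀ i ∉ S, x i + a i ≤ h
  · exact Or.inl (overflow_emptyCups_le ha hS hh hc)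
  · push Not at hc
    obtain ⟨⟨i₀, hi₀, hi⟩, j₀, hj₀, hj⟩ := hc
    refine Or.inr ⟨?_, overflow_emptyCups_le_mean ha hS hh hmin
      (fun j hj => hgr i₁ hi₁ j hj) hi₀ hj₀ hi hj⟩
    have h1 := hmin i₀ hi₀
    have h2 := hgr i₁ hi₁ j₀ hj₀
    simp only [Pi.add_apply] at h1 h2
    have : ⌈x i₁ + a i₁⌉ = h + 1 := by
      rw [Int.ceil_eq_iff]
      push_cast
      constructor <;> linarith
    omega

/-! ### Mass splitting and spread -/

/-- The signed weights that move a unit mass from `h` to its two neighbours. -/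
noncomputable def splitWeight (h g : ℤ) : ℝ :=
  (if g = h - 1 then 1 / 2 else 0) + (if g = h + 1 then 1 / 2 else 0) - (if g = h then 1 else 0)

theorem sum_splitWeight_mul {I : Finset ℤ} {h : ℤ} (h0 : h ∈ I) (h1 : h - 1 ∈ I)
    (h2 : h + 1 ∈ I) (φ : ℤ → ℝ) :
    ∑ g ∈ I, splitWeight h g * φ g = (φ (h - 1) + φ (h + 1)) / 2 - φ h := by
  simp only [splitWeight, sub_mul, add_mul, ite_mul, zero_mul, Finset.sum_sub_distrib,
    Finset.sum_add_distrib, Finset.sum_ite_eq', h0, h1, h2, if_true]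
  ring

/-- The distance is a fundamental solution of the discrete Laplacian; this is why a split changes
the spread by a purely local amount. -/
theorem mean_abs_sub (h g : ℤ) :
    (|((h - 1 : ℤ) : ℝ) - g| + |((h + 1 : ℤ) : ℝ) - g|) / 2 - |(h : ℝ) - g| =
      if g = h then 1 else 0 := by
  rcases lt_trichotomy g h with hg | rfl | hg
  · have : (g : ℝ) + 1 ≤ h := by exact_mod_cast hg
    rw [if_neg hg.ne]
    push_cast
    rw [abs_of_nonneg, abs_of_nonneg, abs_of_nonneg] <;> linarith
  · push_cast
    norm_num
  · have : (h : ℝ) + 1 ≤ g := by exact_mod_cast hg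
    rw [if_neg hg.ne']
    push_cast
    rw [abs_of_nonpos, abs_of_nonpos, abs_of_nonpos] <;> linarith

/-- The spread of a mass distribution: the sum of all pairwise distances. -/
noncomputable def spread (I : Finset ℤ) (μ : ℤ → ℝ) : ℝ :=
  ∑ g ∈ I, μ g * ∑ g' ∈ I, μ g' * |(g : ℝ) - g'|

/-- Splitting the mass `m` at one site increases the spread by `m ^ 2`. -/
theorem spread_split {I : Finset ℤ} {h : ℤ} (h0 : h ∈ I) (h1 : h - 1 ∈ I) (h2 : h + 1 ∈ I)
    (μ : ℤ → ℝ) :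
    spread I (fun g => μ g + μ h * splitWeight h g) = spread I μ + μ h ^ 2 := by
  have hin : ∀ g : ℤ, ∑ g' ∈ I, (μ g' + μ h * splitWeight h g') * |(g : ℝ) - g'| =
      ∑ g' ∈ I, μ g' * |(g : ℝ) - g'| + μ h * (if g = h then 1 else 0) := fun g => by
    rw [← mean_abs_sub h g]
    have := sum_splitWeight_mul h0 h1 h2 (fun g' => |(g : ℝ) - g'|)
    simp only [add_mul, Finset.sum_add_distrib, mul_assoc, ← Finset.mul_sum, this]
    simp only [abs_sub_comm]
  have hU : (∑ g' ∈ I, μ g' * |((h - 1 : ℤ) : ℝ) - g'| + ∑ g' ∈ I, μ g' * |((h + 1 : ℤ) : ℝ) - g'|)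
      / 2 - ∑ g' ∈ I, μ g' * |(h : ℝ) - g'| = μ h := by
    rw [← Finset.sum_add_distrib, Finset.sum_div, ← Finset.sum_sub_distrib]
    rw [← Finset.sum_ite_eq_of_mem' I h μ h0]
    refine Finset.sum_congr rfl fun g _ => ?_
    have := mean_abs_sub h g
    rw [show ∀ u v z : ℝ, (μ g * u + μ g * v) / 2 - μ g * z = μ g * ((u + v) / 2 - z) by
      intros; ring, this]
    split_ifs <;> simp
  unfold spread
  simp only [hin]
  have hs := sum_splitWeight_mul h0 h1 h2
    (fun g => ∑ g' ∈ I, μ g' * |(g : ℝ) - g'| + μ h * (if g = h then 1 else 0))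
  simp only [add_mul, Finset.sum_add_distrib, mul_assoc, ← Finset.mul_sum, hs]
  have hd : ∑ g ∈ I, μ g * (if g = h then 1 else 0) = μ h := by simp [h0]
  simp only [mul_add, Finset.sum_add_distrib, mul_left_comm _ (μ h), ← Finset.mul_sum, hd]
  have e1 : (h - 1 = h) = False := by simp
  have e2 : (h + 1 = h) = False := by simp
  simp only [e1, e2, if_true, if_false]
  linear_combination (μ h) * hU

theorem spread_le {I : Finset ℤ} {μ : ℤ → ℝ} {D : ℝ} (hμ : ∀ g, 0 ≤ μ g)
    (hsum : ∑ g ∈ I, μ g = 1) (hD : ∀ g ∈ I, ∀ g' ∈ I, |(g : ℝ) - g'| ≤ D) : spread I μ ≤ D := by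
  have h1 : ∀ g ∈ I, ∑ g' ∈ I, μ g' * |(g : ℝ) - g'| ≤ D := fun g hg => by
    calc _ ≤ ∑ g' ∈ I, μ g' * D :=
          Finset.sum_le_sum fun g' hg' => mul_le_mul_of_nonneg_left (hD g hg g' hg') (hμ _)
      _ = D := by rw [← Finset.sum_mul, hsum, one_mul]
  calc _ ≤ ∑ g ∈ I, μ g * D :=
        Finset.sum_le_sum fun g hg => mul_le_mul_of_nonneg_left (h1 g hg) (hμ _)
    _ = D := by rw [← Finset.sum_mul, hsum, one_mul]

/-! ### Relaxations, the backward dual, and halving across blocks -/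

/-- The levels `h ≥ 0` evolve for `t` rounds so that round `r` raises no level but `θ r`, and that
one to at most the mean of its neighbours, less one half. -/
def IsRelaxation (F : ℕ → ℤ → ℝ) (θ : ℕ → ℤ) (t : ℕ) : Prop :=
  ∀ r < t, ∀ h : ℤ, 0 ≤ h → F (r + 1) h ≤ F r h ∨
    (h = θ r ∧ F (r + 1) h ≤ (F r (h - 1) + F r (h + 1) - 1) / 2)

theorem IsRelaxation.mono {F : ℕ → ℤ → ℝ} {θ : ℕ → ℤ} {s t : ℕ} (hF : IsRelaxation F θ t)
    (hst : s ≤ t) : IsRelaxation F θ s :=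
  fun r hr => hF r (hr.trans_le hst)

/-- The rounds in `[r, t)` that act strictly within distance `w` of level `b`. -/
def visits (θ : ℕ → ℤ) (b w : ℤ) (r t : ℕ) : Finset ℕ :=
  (Finset.Ico r t).filter fun s => |θ s - b| < w

/-- Downward induction on r: mass is split at `θ r` when the mean inequality holds there, while mass
at distance w is frozen at the value M. The last clause is the Cauchy–Schwarz bound in a form that
survives each split. -/
theorem IsRelaxation.exists_dual {F : ℕ → ℤ → ℝ} {θ : ℕ → ℤ} {t : ℕ} (hF : IsRelaxation F θ t)
    {b w : ℤ} {M : ℝ} (hw : 0 < w) (hbw : 0 ≤ b - w)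
    (hlo : ∀ r ≤ t, F r (b - w) ≤ M) (hhi : ∀ r ≤ t, F r (b + w) ≤ M) {r : ℕ} (hr : r ≤ t) :
    ∃ μ : ℤ → ℝ, (∀ g, 0 ≤ μ g) ∧ ∑ g ∈ Finset.Icc (b - w) (b + w), μ g = 1 ∧
      F t b ≤ ∑ g ∈ Finset.Icc (b - w) (b + w), μ g * (if |g - b| < w then F r g else M) ∧
      (∑ g ∈ Finset.Icc (b - w) (b + w), μ g * ((g : ℝ) - b) ^ 2) ^ 2 ≤
        (visits θ b w r t).card * spread (Finset.Icc (b - w) (b + w)) μ := by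
  set I := Finset.Icc (b - w) (b + w) with hI
  induction hr using Nat.decreasingInduction with
  | self =>
    have hb : b ∈ I := by simp [hI]; omega
    refine ⟨fun g => if g = b then 1 else 0, fun g => by dsimp only; split_ifs <;> norm_num, ?_, ?_, ?_⟩
    · simp [hb]
    · simp only [ite_mul, one_mul, zero_mul, Finset.sum_ite_eq', hb, if_true]
      simp [hw]
    · simp [visits]
  | of_succ r hr ih =>
    obtain ⟨μ, hμ, hsum, hle, hvar⟩ := ih
    have hsp : 0 ≤ spread I μ := Finset.sum_nonneg fun g _ =>
      mul_nonneg (hμ g) (Finset.sum_nonneg fun g' _ => mul_nonneg (hμ g') (abs_nonneg _))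
    have hsub : visits θ b w (r + 1) t ⊆ visits θ b w r t := by
      intro s; simp only [visits, Finset.mem_filter, Finset.mem_Ico]; omega
    by_cases hmv : |θ r - b| < w ∧
        F (r + 1) (θ r) ≤ (F r (θ r - 1) + F r (θ r + 1) - 1) / 2
    · obtain ⟨hin, hmv⟩ := hmv
      have hin' := abs_lt.1 hin
      set h := θ r
      have h0 : h ∈ I := by simp [hI]; omega
      have h1 : h - 1 ∈ I := by simp [hI]; omega
      have h2 : h + 1 ∈ I := by simp [hI]; omega
      have key : ∀ φ : ℤ → ℝ, ∑ g ∈ I, (μ g + μ h * splitWeight h g) * φ g =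
          ∑ g ∈ I, μ g * φ g + μ h * ((φ (h - 1) + φ (h + 1)) / 2 - φ h) := fun φ => by
        simp only [add_mul, Finset.sum_add_distrib, mul_assoc, ← Finset.mul_sum,
          sum_splitWeight_mul h0 h1 h2]
      refine ⟨fun g => μ g + μ h * splitWeight h g, fun g => ?_, ?_, ?_, ?_⟩
      · have := hμ h
        have := hμ g
        by_cases hg : g = h
        · subst hg
          have hne : h ≠ h - 1 := by omega
          simp [splitWeight, hne]
        · have : 0 ≤ splitWeight h g := by
            unfold splitWeight
            rw [if_neg hg]
            split_ifs <;> norm_num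
          exact add_nonneg (hμ g) (mul_nonneg (hμ h) this)
      · have := key fun _ => 1
        simp only [mul_one] at this
        rw [this, hsum]
        ring
      · rw [key]
        refine hle.trans ?_
        set G : ℤ → ℝ := fun g => if |g - b| < w then F r g else M with hG
        have hrt : r ≤ t := hr.le
        have hGF : ∀ g ∈ I, F r g ≤ G g := fun g hg => by
          simp only [hG]
          split_ifs with hgw
          · exact le_rfl
          · simp only [hI, Finset.mem_Icc] at hg
            rcases le_or_gt w (g - b) with h3 | h3
            · rw [show g = b + w by omega]; exact hhi r hrt
            · have : g = b - w := by
                by_contra hne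
                exact hgw (abs_lt.2 ⟨by omega, by omega⟩)
              rw [this]; exact hlo r hrt
        have hrest : ∑ g ∈ I, μ g * (if |g - b| < w then F (r + 1) g else M) ≤
            ∑ g ∈ I, (μ g * G g + if g = h then
              μ h * ((G (h - 1) + G (h + 1)) / 2 - G h) else 0) := by
          refine Finset.sum_le_sum fun g hg => ?_
          by_cases hgh : g = h
          · subst hgh
            have e1 := hGF _ h1
            have e2 := hGF _ h2
            have e3 : G h = F r h := by simp [hG, hin]
            rw [if_pos rfl, if_pos hin, ← mul_add]
            refine mul_le_mul_of_nonneg_left ?_ (hμ _)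
            linarith
          · rw [if_neg hgh, add_zero]
            refine mul_le_mul_of_nonneg_left ?_ (hμ _)
            simp only [hG]
            split_ifs with hgw
            · have := abs_lt.1 hgw
              rcases hF r hr g (by omega) with h3 | ⟨h3, -⟩
              · exact h3
              · exact absurd h3 hgh
            · exact le_rfl
        refine hrest.trans_eq ?_
        rw [Finset.sum_add_distrib, Finset.sum_ite_eq_of_mem' I h _ h0]
      · have hcard : ((visits θ b w r t).card : ℝ) = (visits θ b w (r + 1) t).card + 1 := by
          have : visits θ b w r t = insert r (visits θ b w (r + 1) t) := by
            ext s
            simp only [visits, Finset.mem_filter, Finset.mem_Ico, Finset.mem_insert]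
            constructor
            · rintro ⟨⟨h3, h4⟩, h5⟩
              rcases h3.eq_or_lt with h6 | h6
              · exact Or.inl h6.symm
              · exact Or.inr ⟨⟨h6, h4⟩, h5⟩
            · rintro (rfl | ⟨⟨h3, h4⟩, h5⟩)
              · exact ⟨⟨le_rfl, hr⟩, hin⟩
              · exact ⟨⟨by omega, h4⟩, h5⟩
          rw [this, Finset.card_insert_of_notMem (by simp [visits])]
          push_cast
          ring
        rw [key, spread_split h0 h1 h2, hcard]
        push_cast
        set V := ∑ g ∈ I, μ g * ((g : ℝ) - b) ^ 2
        set N : ℝ := ((visits θ b w (r + 1) t).card : ℝ)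
        set m := μ h
        have hN : 0 ≤ N := Nat.cast_nonneg _
        have hm : 0 ≤ m := hμ h
        have e : V + m * (((((h : ℝ) - 1 - b) ^ 2 + ((h : ℝ) + 1 - b) ^ 2)) / 2 - ((h : ℝ) - b) ^ 2)
            = V + m := by ring
        rw [e]
        -- AM–GM on V² ≤ N · spread; this is the cross term needed for (V + m)² ≤ (N + 1)(spread +
        -- m²).
        have hcs : 2 * V * m ≤ spread I μ + N * m ^ 2 := by
          refine abs_le_of_sq_le_sq' ?_ (by positivity) |>.2
          nlinarith [sq_nonneg (spread I μ - N * m ^ 2),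
            mul_le_mul_of_nonneg_right hvar (sq_nonneg m)]
        nlinarith
    · refine ⟨μ, hμ, hsum, hle.trans ?_, hvar.trans ?_⟩
      · refine Finset.sum_le_sum fun g hg => mul_le_mul_of_nonneg_left ?_ (hμ g)
        split_ifs with hgw
        · have := abs_lt.1 hgw
          rcases hF r hr g (by omega) with h3 | ⟨rfl, h3⟩
          · exact h3
          · exact absurd ⟨hgw, h3⟩ hmv
        · exact le_rfl
      · exact mul_le_mul_of_nonneg_right (by exact_mod_cast Finset.card_le_card hsub) hsp

/-- A block of half-width `w` that is visited at most `w ^ 3 / 8` times passes on at most half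
of the value at its boundary. -/
theorem IsRelaxation.le_half {F : ℕ → ℤ → ℝ} {θ : ℕ → ℤ} {t : ℕ} (hF : IsRelaxation F θ t)
    (h0 : ∀ h, 0 ≤ h → F 0 h ≤ 0) {b w : ℤ} {M : ℝ} (hw : 0 < w) (hbw : 0 ≤ b - w) (hM : 0 ≤ M)
    (hlo : ∀ r ≤ t, F r (b - w) ≤ M) (hhi : ∀ r ≤ t, F r (b + w) ≤ M)
    (hN : 8 * ((visits θ b w 0 t).card : ℤ) ≤ w ^ 3) : F t b ≤ M / 2 := by
  obtain ⟨μ, hμ, hsum, hle, hvar⟩ := hF.exists_dual hw hbw hlo hhi (Nat.zero_le t)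
  set I := Finset.Icc (b - w) (b + w) with hI
  have hwr : (0 : ℝ) < w := by exact_mod_cast hw
  have hNr : 8 * ((visits θ b w 0 t).card : ℝ) ≤ (w : ℝ) ^ 3 := by exact_mod_cast hN
  have hsp : spread I μ ≤ 2 * w := by
    refine spread_le hμ hsum fun g hg g' hg' => ?_
    simp only [hI, Finset.mem_Icc] at hg hg'
    have : |g - g'| ≤ 2 * w := abs_le.2 ⟨by omega, by omega⟩
    exact_mod_cast this
  set V := ∑ g ∈ I, μ g * ((g : ℝ) - b) ^ 2 with hV
  have hV2 : V ≤ (w : ℝ) ^ 2 / 2 := by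
    refine abs_le_of_sq_le_sq' ?_ (by positivity) |>.2
    calc V ^ 2 ≤ (visits θ b w 0 t).card * spread I μ := hvar
      _ ≤ (w : ℝ) ^ 3 / 8 * (2 * w) := by
        refine mul_le_mul (by linarith) hsp ?_ (by positivity)
        exact Finset.sum_nonneg fun g _ =>
          mul_nonneg (hμ g) (Finset.sum_nonneg fun g' _ => mul_nonneg (hμ g') (abs_nonneg _))
      _ = _ := by ring
  calc F t b ≤ _ := hle
    -- Chebyshev: interior sites carry initial values ≤ 0, and edge sites have (g - b)² ≥ w².
    _ ≤ ∑ g ∈ I, μ g * ((g : ℝ) - b) ^ 2 * (M / (w : ℝ) ^ 2) := by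
      refine Finset.sum_le_sum fun g hg => ?_
      rw [mul_assoc]
      refine mul_le_mul_of_nonneg_left ?_ (hμ g)
      simp only [hI, Finset.mem_Icc] at hg
      split_ifs with hgw
      · exact (h0 g (by omega)).trans (by positivity)
      · have : (w : ℝ) ^ 2 ≤ ((g : ℝ) - b) ^ 2 := by
          rw [← sq_abs ((g : ℝ) - b)]
          have : (w : ℝ) ≤ |(g : ℝ) - b| := by exact_mod_cast not_lt.1 hgw
          gcongr
        rw [← mul_div_assoc, le_div_iff₀ (by positivity), mul_comm]
        gcongr
    _ = V * (M / (w : ℝ) ^ 2) := by rw [← Finset.sum_mul]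
    _ ≤ (w : ℝ) ^ 2 / 2 * (M / (w : ℝ) ^ 2) := by gcongr
    _ = M / 2 := by field_simp

theorem sum_card_visits_le (θ : ℕ → ℤ) {w : ℤ} (hw : 0 < w) (t N : ℕ) :
    ∑ j ∈ Finset.range N, (visits θ ((2 * j + 1) * w) w 0 t).card ≤ t := by
  rw [← Finset.card_biUnion]
  · calc _ ≤ (Finset.range t).card := Finset.card_le_card fun s hs => by
          simp only [Finset.mem_biUnion, visits, Finset.mem_filter, Finset.mem_Ico] at hs
          obtain ⟨j, -, hs, -⟩ := hs
          simpa using hs.2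
      _ = t := Finset.card_range t
  · have key : ∀ i j : ℕ, i < j → Disjoint (visits θ ((2 * i + 1) * w) w 0 t)
        (visits θ ((2 * j + 1) * w) w 0 t) := fun i j hij => by
      rw [Finset.disjoint_left]
      intro s h1 h2
      simp only [visits, Finset.mem_filter] at h1 h2
      have h3 := (abs_lt.1 h1.2).2
      have h4 := (abs_lt.1 h2.2).1
      have : (i : ℤ) + 1 ≤ j := by exact_mod_cast hij
      nlinarith
    intro i _ j _ hij
    rcases lt_or_gt_of_ne hij with h | h
    · exact key i j h
    · exact (key j i h).symm

/-- In `t ≤ m * w ^ 3 / 8` rounds, the value at level `4 * m * w` has been halved `m` times. -/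
theorem IsRelaxation.le_pow {F : ℕ → ℤ → ℝ} {θ : ℕ → ℤ} {t m : ℕ} (hF : IsRelaxation F θ t)
    (h0 : ∀ h, 0 ≤ h → F 0 h ≤ 0) (hanti : ∀ r, Antitone (F r)) {w : ℤ} {M : ℝ} (hw : 0 < w)
    (hM : 0 ≤ M) (hbase : ∀ r ≤ t, F r 0 ≤ M) (ht : 8 * (t : ℤ) ≤ m * w ^ 3) {r : ℕ}
    (hr : r ≤ t) : F r (4 * m * w) ≤ M * (1 / 2) ^ m := by
  -- Visits are counted up to the final time t, so one classification of blocks serves every r ≤ t.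
  let light : ℕ → Prop := fun j => 8 * ((visits θ ((2 * j + 1) * w) w 0 t).card : ℤ) ≤ w ^ 3
  classical
  have hind : ∀ i : ℕ, ∀ r ≤ t,
      F r (2 * i * w) ≤ M * (1 / 2) ^ ((Finset.range i).filter light).card := by
    intro i
    induction i with
    | zero => intro r hr; simpa using hbase r hr
    | succ i ih =>
      intro r hr
      rw [Finset.range_add_one, Finset.filter_insert]
      have hiw : 0 ≤ (i : ℤ) * w := by positivity
      split_ifs with hl
      · rw [Finset.card_insert_of_notMem (by simp), pow_succ, ← mul_assoc, mul_one_div]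
        refine le_trans (hanti r (a := (2 * i + 1) * w) ?_) ?_
        · push_cast; nlinarith
        · refine (hF.mono hr).le_half h0 hw ?_ (by positivity) ?_ ?_ ?_
          · nlinarith
          · intro s hs
            rw [show (2 * (i : ℤ) + 1) * w - w = 2 * i * w by ring]
            exact ih s (hs.trans hr)
          · intro s hs
            refine (hanti s ?_).trans (ih s (hs.trans hr))
            nlinarith
          · refine le_trans ?_ hl
            have : visits θ ((2 * i + 1) * w) w 0 r ⊆ visits θ ((2 * i + 1) * w) w 0 t := by
              intro s; simp only [visits, Finset.mem_filter, Finset.mem_Ico]; omega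
            have := Finset.card_le_card this
            omega
      · refine (hanti r ?_).trans (ih r hr)
        push_cast; nlinarith
  have hcount : m ≤ ((Finset.range (2 * m)).filter light).card := by
    have hsplit := Finset.card_filter_add_card_filter_not (s := Finset.range (2 * m)) light
    rw [Finset.card_range] at hsplit
    suffices hh : ((Finset.range (2 * m)).filter fun j => ¬ light j).card ≤ m by omega
    have h1 : (((Finset.range (2 * m)).filter fun j => ¬ light j).card : ℤ) * w ^ 3 ≤ 8 * t := by
      calc _ = ∑ j ∈ (Finset.range (2 * m)).filter fun j => ¬ light j, w ^ 3 := by simp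
        _ ≤ ∑ j ∈ (Finset.range (2 * m)).filter fun j => ¬ light j,
              8 * ((visits θ ((2 * j + 1) * w) w 0 t).card : ℤ) :=
            Finset.sum_le_sum fun j hj => (not_le.1 (Finset.mem_filter.1 hj).2).le
        _ ≤ ∑ j ∈ Finset.range (2 * m), 8 * ((visits θ ((2 * j + 1) * w) w 0 t).card : ℤ) :=
            Finset.sum_le_sum_of_subset_of_nonneg (Finset.filter_subset _ _)
              fun _ _ _ => by positivity
        _ ≤ 8 * t := by
            rw [← Finset.mul_sum]
            have := sum_card_visits_le θ hw t (2 * m)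
            zify at this
            omega
    have h2 := le_of_mul_le_mul_right (h1.trans ht) (by positivity : 0 < w ^ 3)
    exact_mod_cast h2
  have := hind (2 * m) r hr
  rw [show (2 : ℤ) * ((2 * m : ℕ) : ℤ) * w = 4 * m * w by push_cast; ring] at this
  refine this.trans (mul_le_mul_of_nonneg_left ?_ hM)
  exact pow_le_pow_of_le_one (by norm_num) (by norm_num) hcount

/-! ### Parabolic barriers -/

theorem parabola_step (u : ℝ) :
    (max (u + 1) 0 ^ 2 / 2 + max (u - 1) 0 ^ 2 / 2 - 1) / 2 ≤ max u 0 ^ 2 / 2 := by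
  rcases le_total u 0 with hu | hu
  · rw [max_eq_right hu, max_eq_right (by linarith : u - 1 ≤ 0)]
    have : max (u + 1) 0 ≤ 1 := max_le (by linarith) (by norm_num)
    nlinarith [le_max_right (u + 1) 0]
  · rw [max_eq_left hu, max_eq_left (by linarith : 0 ≤ u + 1)]
    have : max (u - 1) 0 ^ 2 ≤ (u - 1) ^ 2 := by
      rcases max_cases (u - 1) 0 with ⟨h, -⟩ | ⟨h, -⟩
      · rw [h]
      · rw [h]; nlinarith
    nlinarith

/-- Above a level where the values never exceed `J ^ 2 / 2`, they stay below a parabola that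
vanishes at height `J`. -/
theorem IsRelaxation.le_parabola {F : ℕ → ℤ → ℝ} {θ : ℕ → ℤ} {t : ℕ} (hF : IsRelaxation F θ t)
    (h0 : ∀ h, 0 ≤ h → F 0 h ≤ 0) {b : ℤ} (hb : 0 ≤ b) {J : ℝ} (hJ : 0 ≤ J)
    (hbase : ∀ r ≤ t, F r b ≤ J ^ 2 / 2) :
    ∀ r ≤ t, ∀ h, b ≤ h → F r h ≤ max (J - (h - b)) 0 ^ 2 / 2 := by
  intro r
  induction r with
  | zero => intro _ h hh; exact (h0 h (hb.trans hh)).trans (by positivity)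
  | succ r ih =>
    intro hr h hh
    rcases hh.eq_or_lt with rfl | hlt
    · simpa [max_eq_left hJ] using hbase _ hr
    · rcases hF r (by omega) h (by omega) with h1 | ⟨-, h1⟩
      · exact h1.trans (ih (by omega) h hh)
      · have e1 := ih (by omega) (h - 1) (by omega)
        have e2 := ih (by omega) (h + 1) (by omega)
        push_cast at e1 e2
        have := parabola_step (J - (h - b))
        rw [show J - ((h : ℝ) - 1 - b) = J - (h - b) + 1 by ring] at e1
        rw [show J - ((h : ℝ) + 1 - b) = J - (h - b) - 1 by ring] at e2
        linarith

/-- Level -1 is not governed by the relaxation; the slope bound replaces it, since J²/2 + J ≤ (J +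
1)²/2. -/
theorem IsRelaxation.le_parabola_of_slope {F : ℕ → ℤ → ℝ} {θ : ℕ → ℤ} {t : ℕ}
    (hF : IsRelaxation F θ t) (h0 : ∀ h, 0 ≤ h → F 0 h ≤ 0) {J : ℝ} (hJ : 0 ≤ J)
    (hslope : ∀ r, F r (-1) ≤ F r 0 + J) :
    ∀ r ≤ t, ∀ h : ℤ, 0 ≤ h → F r h ≤ max (J - h) 0 ^ 2 / 2 := by
  intro r
  induction r with
  | zero => intro _ h hh; exact (h0 h hh).trans (by positivity)
  | succ r ih =>
    intro hr h hh
    rcases hF r (by omega) h (by omega) with h1 | ⟨-, h1⟩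
    · exact h1.trans (ih (by omega) h hh)
    · have e1 : F r (h - 1) ≤ max (J - h + 1) 0 ^ 2 / 2 := by
        rcases hh.eq_or_lt with rfl | hlt
        · have e3 := ih (by omega) 0 le_rfl
          have e4 := hslope r
          simp only [Int.cast_zero, sub_zero, max_eq_left hJ] at e3 ⊢
          rw [max_eq_left (by linarith)]
          norm_num
          linarith
        · have e1 := ih (by omega) (h - 1) (by omega)
          push_cast at e1
          rwa [show J - ((h : ℝ) - 1) = J - h + 1 by ring] at e1
      have e2 := ih (by omega) (h + 1) (by omega)
      push_cast at e2
      have := parabola_step (J - h)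
      rw [show J - ((h : ℝ) + 1) = J - h - 1 by ring] at e2
      linarith

/-! ### From the game to relaxations; time and backlog bounds -/

theorem GreedyReachable.exists_path {n t : ℕ} {x : Fin n → ℝ} (hx : GreedyReachable n t x) :
    ∃ X : ℕ → Fin n → ℝ, X 0 = (fun _ => 0) ∧ X t = x ∧ ∀ r < t, GreedyRound (X r) (X (r + 1)) := by
  induction hx with
  | start => exact ⟨fun _ _ => 0, rfl, rfl, by simp⟩
  | @round t x y hx hxy ih =>
    obtain ⟨X, h0, ht, hX⟩ := ih
    refine ⟨fun r => if r ≤ t then X r else y, by simp [h0], by simp, fun r hr => ?_⟩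
    rcases (Nat.lt_succ_iff.1 hr).eq_or_lt with rfl | h
    · simpa [ht] using hxy
    · simpa [h.le, Nat.succ_le_of_lt h] using hX r h

theorem GreedyReachable.exists_relaxation {n t : ℕ} {x : Fin n → ℝ}
    (hx : GreedyReachable n t x) : ∃ (X : ℕ → Fin n → ℝ) (θ : ℕ → ℤ), X t = x ∧
      (∀ h, 0 ≤ h → overflow (X 0) h ≤ 0) ∧ IsRelaxation (fun r => overflow (X r)) θ t := by
  obtain ⟨X, h0, ht, hX⟩ := hx.exists_path
  have : ∀ r, ∃ θ : ℤ, r < t → ∀ h : ℤ, 0 ≤ h → overflow (X (r + 1)) h ≤ overflow (X r) h ∨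
      (h = θ ∧ overflow (X (r + 1)) h ≤
        (overflow (X r) (h - 1) + overflow (X r) (h + 1) - 1) / 2) := fun r => by
    by_cases hr : r < t
    · obtain ⟨θ, hθ⟩ := (hX r hr).overflow_le
      exact ⟨θ, fun _ => hθ⟩
    · exact ⟨0, fun h => absurd h hr⟩
  choose θ hθ using this
  refine ⟨X, θ, ht, fun h hh => ?_, hθ⟩
  have : (0 : ℝ) ≤ h := by exact_mod_cast hh
  simp [h0, overflow, this]

theorem GreedyReachable.bounds {n t : ℕ} {x : Fin n → ℝ} (hx : GreedyReachable n t x) :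
    ∀ i, 0 ≤ x i ∧ x i ≤ t := by
  induction hx with
  | start => simp
  | round hx hxy ih =>
    intro i
    refine ⟨hxy.nonneg (fun i => (ih i).1) i, ?_⟩
    push_cast
    linarith [hxy.le_add_one (fun i => (ih i).1) i, (ih i).2]

theorem backlog_le {n : ℕ} (hn : 1 ≤ n) {x : Fin n → ℝ} {B : ℝ} (hx : ∀ i, x i ≤ B) :
    backlog x ≤ B :=
  haveI : Nonempty (Fin n) := ⟨⟨0, hn⟩⟩
  ciSup_le hx

theorem GreedyReachable.backlog_le_time {n t : ℕ} {x : Fin n → ℝ} (hx : GreedyReachable n t x)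
    (hn : 1 ≤ n) : backlog x ≤ t :=
  backlog_le hn fun i => (hx.bounds i).2

theorem overflow_le_parabola {n t : ℕ} {X : ℕ → Fin n → ℝ} {θ : ℕ → ℤ}
    (h0 : ∀ h, 0 ≤ h → overflow (X 0) h ≤ 0) (hF : IsRelaxation (fun r => overflow (X r)) θ t) :
    ∀ r ≤ t, ∀ h : ℤ, 0 ≤ h → overflow (X r) h ≤ max ((n : ℝ) - h) 0 ^ 2 / 2 :=
  hF.le_parabola_of_slope h0 (Nat.cast_nonneg n) fun r => overflow_sub_one_le (X r) 0

theorem GreedyReachable.backlog_le_card {n t : ℕ} {x : Fin n → ℝ} (hx : GreedyReachable n t x)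
    (hn : 1 ≤ n) : backlog x ≤ n := by
  obtain ⟨X, θ, rfl, h0, hF⟩ := hx.exists_relaxation
  have := overflow_le_parabola h0 hF t le_rfl n (by positivity)
  simp only [Int.cast_natCast, sub_self, max_self] at this
  refine backlog_le hn fun i => ?_
  have := le_of_overflow_nonpos (x := X t) (h := n) (by norm_num at this ⊢; exact this) i
  exact_mod_cast this

/-- If `16 n² ≤ 2ᵐ k²`, a backlog of `k ≥ 16 m w` takes more than `m w³ / 8` rounds. -/
theorem GreedyReachable.lt_time {n t m w : ℕ} {x : Fin n → ℝ} (hx : GreedyReachable n t x)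
    (hn : 1 ≤ n) (hm : 1 ≤ m) (hw : 1 ≤ w) {k : ℝ} (hk : k ≤ backlog x)
    (hmk : 16 * (n : ℝ) ^ 2 ≤ 2 ^ m * k ^ 2) (hmw : 16 * (m : ℝ) * w ≤ k) :
    m * w ^ 3 < 8 * t := by
  by_contra hcon
  push Not at hcon
  obtain ⟨X, θ, rfl, h0, hF⟩ := hx.exists_relaxation
  have hm' : (1 : ℝ) ≤ m := by exact_mod_cast hm
  have hw' : (1 : ℝ) ≤ w := by exact_mod_cast hw
  have hmw1 : (1 : ℝ) ≤ m * w := one_le_mul_of_one_le_of_one_le hm' hw'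
  have hk16 : 16 ≤ k := by nlinarith
  have hbase : ∀ r ≤ t, overflow (X r) 0 ≤ (n : ℝ) ^ 2 / 2 := fun r hr => by
    simpa using overflow_le_parabola h0 hF r hr 0 le_rfl
  have hpow : ∀ r ≤ t, overflow (X r) (4 * m * w) ≤ (k / 4) ^ 2 / 2 := fun r hr => by
    refine (hF.le_pow (m := m) (w := w) h0 (fun r _ _ h => overflow_anti (X r) h)
      (by exact_mod_cast hw) (by positivity) hbase (by exact_mod_cast hcon) hr).trans ?_
    rw [one_div, inv_pow, ← div_eq_mul_inv, div_le_iff₀ (by positivity)]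
    nlinarith
  have hpar := hF.le_parabola h0 (b := 4 * m * w) (by positivity) (J := k / 4) (by positivity)
    hpow t le_rfl (4 * m * w + ⌈k / 4⌉) 
    (by have := Int.ceil_nonneg (a := k / 4) (by positivity); omega)
  have hz : k / 4 - (((4 * m * w + ⌈k / 4⌉ : ℤ) : ℝ) - ((4 * m * w : ℤ) : ℝ)) ≤ 0 := by
    push_cast
    linarith [Int.le_ceil (k / 4)]
  rw [max_eq_right hz] at hpar
  have hfin : backlog (X t) ≤ ((4 * m * w + ⌈k / 4⌉ : ℤ) : ℝ) :=
    backlog_le hn fun i => le_of_overflow_nonpos (by norm_num at hpar ⊢; exact hpar) i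
  push_cast at hfin
  linarith [Int.ceil_lt_add_one (k / 4)]

theorem GreedyReachable.exists_time_bound : ∃ c : ℝ, 0 < c ∧
    ∀ (n t : ℕ) (k : ℝ) (x : Fin n → ℝ), 1 ≤ n → 1 ≤ k → GreedyReachable n t x → k ≤ backlog x →
      c * (k + k ^ 3 / Real.log ((n : ℝ) / k + 1) ^ 2) ≤ (t : ℝ) := by
  refine ⟨1 / (2 ^ 24 + 1), by norm_num, fun n t k x hn hk1 hx hk => ?_⟩
  have hkn : k ≤ n := hk.trans (hx.backlog_le_card hn)
  have hkt : k ≤ t := hk.trans (hx.backlog_le_time hn)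
  have hk0 : 0 < k := by linarith
  set u : ℝ := (n : ℝ) / k with hu
  have hu1 : 1 ≤ u := (one_le_div hk0).2 hkn
  have huk : u * k = n := div_mul_cancel₀ _ hk0.ne'
  set L := Real.log (u + 1) with hL
  have hlog2 := Real.log_two_gt_d9
  have hL2 : Real.log 2 ≤ L := Real.log_le_log (by norm_num) (by linarith)
  have hL0 : 0 < L := by linarith
  -- Since 6 log 2 ≥ 4, this gives 2ᵐ ≥ (u + 1)⁴ ≥ 16u², the hypothesis of `lt_time`.
  set m := ⌈6 * L⌉₊ with hm
  have hm6 : 6 * L ≤ m := Nat.le_ceil _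
  have hm8 : (m : ℝ) ≤ 8 * L := by
    have := Nat.ceil_lt_add_one (a := 6 * L) (by positivity)
    linarith
  have hm0 : (0 : ℝ) < m := by linarith
  have hm1 : 1 ≤ m := by exact_mod_cast hm0
  suffices hs : k ^ 3 / L ^ 2 ≤ 2 ^ 24 * t by
    rw [one_div, inv_mul_le_iff₀ (by norm_num)]
    linarith
  rw [div_le_iff₀ (by positivity)]
  -- Here no w ≥ 1 fits, but k = O(L), so t ≥ k already suffices.
  by_cases hkm : k < 16 * m
  · have h1 : k ≤ 128 * L := by linarith
    have h2 : k ^ 2 ≤ (128 * L) ^ 2 := by gcongr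
    calc k ^ 3 = k * k ^ 2 := by ring
      _ ≤ t * (128 * L) ^ 2 := by gcongr
      _ ≤ 2 ^ 24 * t * L ^ 2 := by nlinarith [mul_nonneg (Nat.cast_nonneg (α := ℝ) t) (sq_nonneg L)]
  · push Not at hkm
    have hq : 1 ≤ k / (16 * m) := (one_le_div (by positivity)).2 hkm
    set w := ⌊k / (16 * m)⌋₊ with hw
    have hw1 : 1 ≤ w := Nat.le_floor (by exact_mod_cast hq)
    have hwle : (w : ℝ) ≤ k / (16 * m) := Nat.floor_le (by linarith)
    have hwlt : k / (16 * m) < w + 1 := Nat.lt_floor_add_one _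
    have hw1' : (1 : ℝ) ≤ w := by exact_mod_cast hw1
    rw [le_div_iff₀ (by positivity)] at hwle
    rw [div_lt_iff₀ (by positivity)] at hwlt
    have hpow : (u + 1) ^ 4 ≤ 2 ^ m := by
      have e1 : (2 : ℝ) ^ m = Real.exp (m * Real.log 2) := by
        rw [Real.exp_nat_mul, Real.exp_log (by norm_num)]
      have e2 : (u + 1) ^ 4 = Real.exp ((4 : ℕ) * L) := by
        rw [Real.exp_nat_mul, Real.exp_log (by linarith)]
      rw [e1, e2, Real.exp_le_exp]
      push_cast
      nlinarith
    have hmk : 16 * (n : ℝ) ^ 2 ≤ 2 ^ m * k ^ 2 := by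
      have h1 : 16 * u ^ 2 ≤ (u + 1) ^ 4 := by
        have : 4 * u ≤ (u + 1) ^ 2 := by nlinarith [sq_nonneg (u - 1)]
        nlinarith
      calc 16 * (n : ℝ) ^ 2 = 16 * u ^ 2 * k ^ 2 := by rw [← huk]; ring
        _ ≤ 2 ^ m * k ^ 2 := by gcongr; exact h1.trans hpow
    have ht := hx.lt_time hn hm1 hw1 hk hmk (by linarith)
    have ht' : (m : ℝ) * w ^ 3 < 8 * t := by exact_mod_cast ht
    have h1 : k ≤ 32 * (m * w) := by nlinarith
    calc k ^ 3 ≤ (32 * (m * w)) ^ 3 := by gcongr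
      _ = 32768 * (m : ℝ) ^ 2 * (m * w ^ 3) := by ring
      _ ≤ 32768 * (8 * L) ^ 2 * (8 * t) := by gcongr
      _ = 2 ^ 24 * t * L ^ 2 := by ring

theorem GreedyReachable.exists_backlog_bound : ∃ C : ℝ, 0 < C ∧
    ∀ (n t : ℕ), 1 ≤ n → 1 ≤ t →
      ∀ x : Fin n → ℝ, GreedyReachable n t x → backlog x ≤ C * tradeoff n t := by
  obtain ⟨c, hc, H⟩ := GreedyReachable.exists_time_bound
  set A : ℝ := max 2 (4 / c) with hA
  have hA2 : 2 ≤ A := le_max_left _ _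
  have hAc : 4 / c ≤ A := le_max_right _ _
  refine ⟨A, by linarith, fun n t hn ht x hx => ?_⟩
  have hn' : (1 : ℝ) ≤ n := by exact_mod_cast hn
  have ht' : (1 : ℝ) ≤ t := by exact_mod_cast ht
  unfold tradeoff
  split_ifs with h1 h2
  · exact (hx.backlog_le_time hn).trans (by nlinarith)
  · have h2' : (t : ℝ) ≤ (n : ℝ) ^ 3 := by exact_mod_cast h2
    set v : ℝ := (n : ℝ) ^ 3 / t with hv
    have hv1 : 1 ≤ v := (one_le_div (by linarith)).2 h2'
    have hvt : v * t = (n : ℝ) ^ 3 := div_mul_cancel₀ _ (by linarith)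
    set ℓ := Real.log (v + 1) with hℓ
    have hlog2 := Real.log_two_gt_d9
    have hℓ2 : Real.log 2 ≤ ℓ := Real.log_le_log (by norm_num) (by linarith)
    have hℓ0 : 0 < ℓ := by linarith
    set β := (t : ℝ) ^ (1 / 3 : ℝ) * ℓ ^ (2 / 3 : ℝ) with hβ
    have hβ0 : 0 < β := by positivity
    have hβ3 : β ^ 3 = t * ℓ ^ 2 := by
      rw [hβ, mul_pow, ← Real.rpow_natCast, ← Real.rpow_natCast, ← Real.rpow_mul (by linarith),
        ← Real.rpow_mul hℓ0.le]
      norm_num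
    by_contra hcon
    push Not at hcon
    set k := backlog x with hk
    have hAβ0 : 0 < A * β := by positivity
    have hk0 : 0 < k := hAβ0.trans hcon
    have hk3 : A ^ 3 * (t * ℓ ^ 2) < k ^ 3 := by
      rw [← hβ3, ← mul_pow]
      gcongr
    have hℓsq : 0.4 ≤ ℓ ^ 2 := by nlinarith
    have hA3 : 4 * A ≤ A ^ 3 := by nlinarith [mul_self_nonneg (A - 2)]
    have hA8 : 8 ≤ A ^ 3 := by linarith
    have htk : 3 * t ≤ k ^ 3 := by
      have e1 : 0.4 * (t : ℝ) ≤ t * ℓ ^ 2 := by nlinarith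
      have e2 : 8 * (0.4 * (t : ℝ)) ≤ A ^ 3 * (t * ℓ ^ 2) := by gcongr
      linarith
    have hk1 : 1 ≤ k := by
      by_contra hlt
      have : k ^ 3 ≤ 1 := pow_le_one₀ hk0.le (by linarith)
      linarith
    have hkt := H n t k x hn hk1 hx le_rfl
    set L := Real.log ((n : ℝ) / k + 1) with hL
    have hnk : 0 < (n : ℝ) / k := by positivity
    have hL0 : 0 < L := Real.log_pos (by linarith)
    -- From t ≤ k³ comes (n/k)³ ≤ v; as v ≥ 1, also n/k ≤ v.
    have hLℓ : L ≤ ℓ := by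
      refine Real.log_le_log (by linarith) ?_
      have h3 : ((n : ℝ) / k) ^ 3 ≤ v := by
        rw [div_pow, div_le_iff₀ (by positivity), ← hvt]
        gcongr
        linarith
      by_cases hle : (n : ℝ) / k ≤ 1
      · linarith
      · have := le_self_pow₀ (not_le.1 hle).le (n := 3) (by norm_num)
        linarith
    have h4 : c * (k ^ 3 / ℓ ^ 2) ≤ t := by
      have h5 : k ^ 3 / ℓ ^ 2 ≤ k ^ 3 / L ^ 2 := by gcongr
      have : c * (k ^ 3 / ℓ ^ 2) ≤ c * (k + k ^ 3 / L ^ 2) := by gcongr; linarith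
      linarith
    have h6 : A ^ 3 * t < k ^ 3 / ℓ ^ 2 := by
      rw [lt_div_iff₀ (by positivity)]
      linarith
    have h7 : 4 ≤ c * A := by
      rw [div_le_iff₀ hc] at hAc
      linarith
    have h8 : 1 ≤ c * A ^ 3 := by nlinarith
    nlinarith
  · exact (hx.backlog_le_card hn).trans (by nlinarith)

theorem mainTheorem3 :
    (∀ C : ℝ, 0 < C → ∃ c : ℝ, 0 < c ∧
      ∀ (n : ℕ) (k : ℝ), 1 ≤ k → k ≤ C * (n : ℝ) →
        ∀ (t : ℕ) (x : Fin n → ℝ), GreedyReachable n t x → k ≤ backlog x →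
          c * (k + k ^ 3 / Real.log ((n : ℝ) / k + 1) ^ 2) ≤ (t : ℝ)) ∧
    (∃ C : ℝ, 0 < C ∧
      ∀ (n t : ℕ), 1 ≤ n → 1 ≤ t →
        ∀ x : Fin n → ℝ, GreedyReachable n t x → backlog x ≤ C * tradeoff n t) ∧
    (∀ δ : ℝ, 0 < δ → ∃ c : ℝ, 0 < c ∧
      ∀ (n : ℕ), 1 ≤ n →
        ∀ (t : ℕ) (x : Fin n → ℝ), GreedyReachable n t x → δ * (n : ℝ) ≤ backlog x →
          c * (n : ℝ) ^ 3 ≤ (t : ℝ)) := by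
  obtain ⟨c, hc, H⟩ := GreedyReachable.exists_time_bound
  refine ⟨fun C _ => ⟨c, hc, fun n k hk1 hkC t x hx hk => ?_⟩,
    GreedyReachable.exists_backlog_bound, fun δ hδ => ?_⟩
  · refine H n t k x (Nat.one_le_iff_ne_zero.2 ?_) hk1 hx hk
    rintro rfl
    simp only [Nat.cast_zero, mul_zero] at hkC
    linarith
  · set L := Real.log (1 / δ + 1) with hL
    have hL0 : 0 < L := Real.log_pos (by linarith [one_div_pos.2 hδ])
    refine ⟨min (δ ^ 3) (c * (δ ^ 3 / L ^ 2)), lt_min (by positivity) (by positivity),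
      fun n hn t x hx hk => ?_⟩
    have hn0 : (0 : ℝ) < n := by exact_mod_cast hn
    by_cases hδn : 1 ≤ δ * n
    · have := H n t (δ * n) x hn hδn hx hk
      rw [show (n : ℝ) / (δ * n) = 1 / δ by field_simp] at this
      calc _ ≤ c * (δ ^ 3 / L ^ 2) * (n : ℝ) ^ 3 := by gcongr; exact min_le_right _ _
        _ = c * ((δ * n) ^ 3 / L ^ 2) := by ring
        _ ≤ c * (δ * n + (δ * n) ^ 3 / L ^ 2) := by gcongr; linarith
        _ ≤ t := this
    · have ht : (0 : ℝ) < t := (by positivity : 0 < δ * n).trans_le (hk.trans (hx.backlog_le_time hn))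
      have ht1 : (1 : ℝ) ≤ t := by exact_mod_cast (by exact_mod_cast ht : 0 < t)
      calc _ ≤ δ ^ 3 * (n : ℝ) ^ 3 := by gcongr; exact min_le_left _ _
        _ = (δ * n) ^ 3 := by ring
        _ ≤ 1 := pow_le_one₀ (by positivity) (by linarith)
        _ ≤ t := ht1
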